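/- Let $\mu$ be a nontrivial probability measure on the unit circle $\partial\mathbb D$ (that is, with infinite support). For real functions on $\partial\mathbb D$ put $\langle f,g\rangle=\int fg\,d\mu$ and $\|f\|=(\int|f|^2d\mu)^{1/2}$. Apply the Gram–Schmidt procedure (without normalisation) with respect to $\langle\cdot,\cdot\rangle$ to the ordered system $$1,\ \frac{z-z^{-1}}{2i},\ \frac{z+z^{-1}}2,\ \dots,\ \frac{z^n-z^{-n}}{2i},\ \frac{z^n+z^{-n}}2,\ \dots$$ of real functions on $\partial\mathbb D$. For $n\ge1$ let $b_n>0$ and $a_n>0$ be the norms of the resulting orthogonal functions with leading terms $\frac{z^n-z^{-n}}{2i}$ and $\frac{z^n+z^{-n}}2$, and write these functions as $b_n\pi_n$ and $a_n\sigma_n$ respectively, so that $\pi_n,\sigma_n$ have norm $1$. Put $\sigma_0=1$, $\pi_0=0$, $a_0=b_0=1$, $\beta_0=0$ and, for $n\ge1$, $$\beta_n=\Big\langle\frac{z^n+z^{-n}}2,b_n^{-1}\pi_n\Big\rangle,\quad \imath_n=\Big\langle\frac{z^n+z^{-n}}2,a_{n-1}^{-1}\sigma_{n-1}\Big\rangle,\quad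 \jmath_n=\Big\langle\frac{z^n+z^{-n}}2,b_{n-1}^{-1}\pi_{n-1}\Big\rangle,$$ $$\varsigma_n=\Big\langle\frac{z^n-z^{-n}}{2i},a_{n-1}^{-1}\sigma_{n-1}\Big\rangle,\quad \zeta_n=\Big\langle\frac{z^n-z^{-n}}{2i},b_{n-1}^{-1}\pi_{n-1}\Big\rangle.$$ Let $F(z)=\int_{\partial\mathbb D}\frac{\tau+z}{\tau-z}\,d\mu(\tau)$ for $|z|<1$, let $f_0(z)=\frac1z\,\frac{F(z)-1}{F(z)+1}$, and define recursively for $n\ge0$ $$\gamma_n=f_n(0),\qquad f_{n+1}(z)=\frac1z\,\frac{f_n(z)-\gamma_n}{1-\overline{\gamma_n}f_n(z)},$$ where the removable singularities at $z=0$ are filled in ($\gamma_n$ are the Schur parameters of the Schur function $f_0$ of $\mu$). Then for every $n\ge1$ $$\gamma_{2n-1}=\frac{a_n^2-b_n^2(1-\beta_n^2)}{a_n^2+b_n^2(1+\beta_n^2)}-\frac{2b_n^2\beta_n}{a_n^2+b_n^2(1+\beta_n^2)}\,i,$$ for every $n\ge2$ $$\gamma_{2n-2}=\tfrac12\big(\imath_n+\beta_{n-1}\varsigma_n-\zeta_n\big)-\tfrac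 i2\big(\jmath_n-\imath_n\beta_{n-1}+\varsigma_n\big),$$ and, for the remaining index, $\gamma_0=\imath_1-i\,\varsigma_1$. -/

import Mathlib

open MeasureTheory
open scoped ComplexConjugate

noncomputable section

namespace OTP

/-- The unit circle `∂𝔻`, as a measurable subspace of `ℂ`. -/
abbrev UnitCircle : Type := Metric.sphere (0 : ℂ) 1

/-! ### Trigonometric system and its orthogonalisation -/

/-- `⟨f, g⟩_ℝ = ∫ f g dμ` for real functions on the circle. -/
def realInner (μ : Measure UnitCircle) (f g : UnitCircle → ℝ) : ℝ := ∫ τ, f τ * g τ ∂μ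

/-- `‖f‖_ℝ = (∫ |f|² dμ)^{1/2}`. -/
def realNorm (μ : Measure UnitCircle) (f : UnitCircle → ℝ) : ℝ := Real.sqrt (∫ τ, |f τ| ^ 2 ∂μ)

/-- `(zⁿ + z⁻ⁿ)/2` on the circle, a real function (`cos nθ` at `z = e^{iθ}`). -/
def cosMode (n : ℕ) (z : UnitCircle) : ℝ := (((z : ℂ) ^ n + ((z : ℂ) ^ n)⁻¹) / 2).re

/-- `(zⁿ - z⁻ⁿ)/(2i)` on the circle, a real function (`sin nθ` at `z = e^{iθ}`). -/
def sinMode (n : ℕ) (z : UnitCircle) : ℝ :=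
  (((z : ℂ) ^ n - ((z : ℂ) ^ n)⁻¹) / (2 * Complex.I)).re

theorem inv_pow_eq_conj (n : ℕ) (z : UnitCircle) : ((z : ℂ) ^ n)⁻¹ = conj ((z : ℂ) ^ n) := by
  have hz : ‖(z : ℂ)‖ = 1 := by simp
  apply Complex.inv_eq_conj
  rw [norm_pow, hz, one_pow]

/-- Taking the real part in `cosMode` loses nothing. -/
theorem coe_cosMode (n : ℕ) (z : UnitCircle) :
    (cosMode n z : ℂ) = ((z : ℂ) ^ n + ((z : ℂ) ^ n)⁻¹) / 2 := by
  unfold cosMode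
  rw [inv_pow_eq_conj, Complex.add_conj]
  norm_cast

/-- Taking the real part in `sinMode` loses nothing. -/
theorem coe_sinMode (n : ℕ) (z : UnitCircle) :
    (sinMode n z : ℂ) = ((z : ℂ) ^ n - ((z : ℂ) ^ n)⁻¹) / (2 * Complex.I) := by
  unfold sinMode
  rw [inv_pow_eq_conj, Complex.sub_conj]
  have : ((((2 * ((z : ℂ) ^ n).im : ℝ) : ℂ)) * Complex.I) / (2 * Complex.I)
      = ((((z : ℂ) ^ n).im : ℝ) : ℂ) := by
    have := Complex.I_ne_zero
    push_cast
    field_simp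
  rw [this, Complex.ofReal_re]

/-- The ordered system `1, (z - z⁻¹)/(2i), (z + z⁻¹)/2, …, (zⁿ - z⁻ⁿ)/(2i), (zⁿ + z⁻ⁿ)/2, …`:
index `2n` is the `n`-th cosine mode, index `2n - 1` the `n`-th sine mode. -/
def trigSystem (k : ℕ) : UnitCircle → ℝ :=
  if Even k then cosMode (k / 2) else sinMode ((k + 1) / 2)

/-- Gram–Schmidt orthogonalisation (without normalisation) of `trigSystem` for `⟨·,·⟩_ℝ`. -/
def monicOTP (μ : Measure UnitCircle) (k : ℕ) : UnitCircle → ℝ := fun z =>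
  trigSystem k z - ∑ j : Fin k,
    realInner μ (trigSystem k) (monicOTP μ j) / realInner μ (monicOTP μ j) (monicOTP μ j)
      * monicOTP μ j z
termination_by k
decreasing_by all_goals exact j.2

/-- `aₙ`: the norm of the "monic" element with leading term `(zⁿ + z⁻ⁿ)/2`; `a₀ = 1`. -/
def a (μ : Measure UnitCircle) : ℕ → ℝ
  | 0 => 1
  | n + 1 => realNorm μ (monicOTP μ (2 * (n + 1)))

/-- `bₙ`: the norm of the "monic" element with leading term `(zⁿ - z⁻ⁿ)/(2i)`; `b₀ = 1`. -/
def b (μ : Measure UnitCircle) : ℕ → ℝ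
  | 0 => 1
  | n + 1 => realNorm μ (monicOTP μ (2 * (n + 1) - 1))

/-- The orthonormal `σₙ` (cosine type), with `σ₀ = 1`. -/
def sigma (μ : Measure UnitCircle) : ℕ → UnitCircle → ℝ
  | 0 => fun _ => 1
  | n + 1 => fun z => (a μ (n + 1))⁻¹ * monicOTP μ (2 * (n + 1)) z

/-- The orthonormal `πₙ` (sine type), with `π₀ = 0`. -/
def pi (μ : Measure UnitCircle) : ℕ → UnitCircle → ℝ
  | 0 => fun _ => 0
  | n + 1 => fun z => (b μ (n + 1))⁻¹ * monicOTP μ (2 * (n + 1) - 1) z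

/-- `βₙ = ⟨(zⁿ + z⁻ⁿ)/2, bₙ⁻¹ πₙ⟩_ℝ`; as `π₀ = 0`, this gives `β₀ = 0`. -/
def beta (μ : Measure UnitCircle) (n : ℕ) : ℝ :=
  realInner μ (cosMode n) (fun z => (b μ n)⁻¹ * pi μ n z)

/-- `ıₙ = ⟨(zⁿ + z⁻ⁿ)/2, aₙ₋₁⁻¹ σₙ₋₁⟩_ℝ` for `n ≥ 1`. -/
def iota (μ : Measure UnitCircle) (n : ℕ) : ℝ :=
  realInner μ (cosMode n) (fun z => (a μ (n - 1))⁻¹ * sigma μ (n - 1) z)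

/-- `ȷₙ = ⟨(zⁿ + z⁻ⁿ)/2, bₙ₋₁⁻¹ πₙ₋₁⟩_ℝ` for `n ≥ 1`. -/
def jmath (μ : Measure UnitCircle) (n : ℕ) : ℝ :=
  realInner μ (cosMode n) (fun z => (b μ (n - 1))⁻¹ * pi μ (n - 1) z)

/-- `ςₙ = ⟨(zⁿ - z⁻ⁿ)/(2i), aₙ₋₁⁻¹ σₙ₋₁⟩_ℝ` for `n ≥ 1`. -/
def varsigma (μ : Measure UnitCircle) (n : ℕ) : ℝ :=
  realInner μ (sinMode n) (fun z => (a μ (n - 1))⁻¹ * sigma μ (n - 1) z)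

/-- `ζₙ = ⟨(zⁿ - z⁻ⁿ)/(2i), bₙ₋₁⁻¹ πₙ₋₁⟩_ℝ` for `n ≥ 1`. -/
def zeta (μ : Measure UnitCircle) (n : ℕ) : ℝ :=
  realInner μ (sinMode n) (fun z => (b μ (n - 1))⁻¹ * pi μ (n - 1) z)

/-! ### Carathéodory function, Schur function, Schur algorithm

All functions are functions on `ℂ` of which only the restriction to the open unit disc matters. -/

/-- The Carathéodory function `F(z) = ∫ (τ + z)/(τ - z) dμ(τ)` of `μ`. -/
def caratheodory (μ : Measure UnitCircle) (z : ℂ) : ℂ :=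
  ∫ τ : UnitCircle, ((τ : ℂ) + z) / ((τ : ℂ) - z) ∂μ

/-- The Schur function `f(z) = z⁻¹ (F(z) - 1)/(F(z) + 1)` of `μ`. The quotient
`(F - 1)/(F + 1)` vanishes at `0`, and `dslope` divides it by `z`, filling in the removable
singularity at `0` by the derivative (see `schurFunction_of_ne_zero`). -/
def schurFunction (μ : Measure UnitCircle) : ℂ → ℂ :=
  dslope (fun z => (caratheodory μ z - 1) / (caratheodory μ z + 1)) 0

/-- One step `f ↦ z⁻¹ (f(z) - γ)/(1 - γ̄ f(z))`, `γ = f(0)`, of the Schur algorithm, with the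
removable singularity at `0` filled in (see `schurStep_of_ne_zero`). -/
def schurStep (f : ℂ → ℂ) : ℂ → ℂ :=
  dslope (fun z => (f z - f 0) / (1 - conj (f 0) * f z)) 0

/-- The Schur iterates `fₙ`, starting from the Schur function `f₀` of `μ`. -/
def schurIterate (μ : Measure UnitCircle) : ℕ → ℂ → ℂ
  | 0 => schurFunction μ
  | n + 1 => schurStep (schurIterate μ n)

/-- The Schur parameters `γₙ = fₙ(0)`. -/
def schurParameter (μ : Measure UnitCircle) (n : ℕ) : ℂ := schurIterate μ n 0

theorem caratheodory_zero (μ : Measure UnitCircle) [IsProbabilityMeasure μ] :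
    caratheodory μ 0 = 1 := by
  have h : ∀ τ : UnitCircle, ((τ : ℂ) + 0) / ((τ : ℂ) - 0) = 1 := by
    intro τ
    have hτ : (τ : ℂ) ≠ 0 := by
      intro h0
      have := τ.2
      simp [h0] at this
    simp [hτ]
  simp only [caratheodory, h]
  simp

theorem schurFunction_of_ne_zero (μ : Measure UnitCircle) [IsProbabilityMeasure μ] {z : ℂ}
    (hz : z ≠ 0) :
    schurFunction μ z = 1 / z * ((caratheodory μ z - 1) / (caratheodory μ z + 1)) := by
  unfold schurFunction
  rw [dslope_of_ne _ hz, slope_def_field, caratheodory_zero]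
  simp only [sub_self, zero_div, sub_zero]
  ring

theorem schurStep_of_ne_zero (f : ℂ → ℂ) {z : ℂ} (hz : z ≠ 0) :
    schurStep f z = 1 / z * ((f z - f 0) / (1 - conj (f 0) * f z)) := by
  unfold schurStep
  rw [dslope_of_ne _ hz, slope_def_field]
  simp only [sub_self, zero_div, sub_zero]
  ring

end OTP

end

open Filter Topology

namespace OTP

/-! The Schur algorithm is run on explicit formulas for the iterates near 0. Write C[g](z) = ∫ g/(τ
- z) dμ and let φₙ be the monic orthogonal polynomial of degree n on the circle. Then fₙ = C[conj
φₙ] / C[φₙ τ^(1-n)] near 0 (`IsCauchyQuotient`). For n = 0 this is the definition of the Schur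
function, and one Schur step acts on the pair of Cauchy transforms exactly as the Szegő recursion ψ
= τφ - conj(γ) τⁿ conj φ acts on φ (`IsCauchyQuotient.schurStep`). At z = 0 the formula expresses γₙ
as a quotient of moments of φₙ (`IsCauchyQuotient.apply_zero`).

The real Gram–Schmidt functions supply the φₙ. Let A, B be the unnormalised cosine and sine
functions of degree m + 1. Then A + (β + i)B has leading term τ^(m+1), no τ^(-m-1) term, and is
orthogonal to all lower modes, so multiplying it by τ^m gives φ_{2m+1} (`oddFactor`). Its moments
against τ^(±(m+1)) involve only a, b, β and give the odd parameters. One Szegő step defines φ_{2m+2}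
(`evenFactor`); its moments bring in the remaining coefficients and give the even parameters.

The induction closes because the next odd polynomial is already prescribed by Gram–Schmidt: its
difference from the Szegő step of φ_{2m+2} is a trigonometric polynomial orthogonal to its whole
degree space, hence zero almost everywhere (`IsOddQuotient.oddFactor_succ_ae_eq`). Infinite support
ensures that no denominator vanishes. -/

/-! ### Characters of the circle and Cauchy transforms near the origin. -/

theorem ne_zero_of_mem_circle (τ : UnitCircle) : (τ : ℂ) ≠ 0 :=
  ne_zero_of_mem_unit_sphere τ

/-- The character `τ ↦ τ ^ j` of the circle. -/
noncomputable def character (j : ℤ) (τ : UnitCircle) : ℂ := (τ : ℂ) ^ j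

theorem continuous_character (j : ℤ) : Continuous (character j) :=
  continuous_subtype_val.zpow₀ j fun τ => Or.inl (ne_zero_of_mem_circle τ)

theorem character_zero (τ : UnitCircle) : character 0 τ = 1 := by simp [character]

theorem character_one (τ : UnitCircle) : character 1 τ = τ := by simp [character]

theorem character_add (i j : ℤ) (τ : UnitCircle) :
    character (i + j) τ = character i τ * character j τ :=
  zpow_add₀ (ne_zero_of_mem_circle τ) i j

theorem conj_character (j : ℤ) (τ : UnitCircle) : conj (character j τ) = character (-j) τ := by
  unfold character
  rw [zpow_neg, eq_comm]
  apply Complex.inv_eq_conj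
  simp [norm_zpow]

theorem integrable_of_continuous {E : Type*} [NormedAddCommGroup E]
    (μ : Measure UnitCircle) [IsFiniteMeasure μ] {f : UnitCircle → E} (hf : Continuous f) :
    Integrable f μ := by
  have hc : HasCompactSupport f := HasCompactSupport.of_compactSpace f
  exact hf.integrable_of_hasCompactSupport hc

theorem integrable_mul_of_continuous (μ : Measure UnitCircle) [IsFiniteMeasure μ]
    {f g : UnitCircle → ℂ} (hf : Continuous f) (hg : Continuous g) :
    Integrable (fun τ => f τ * g τ) μ :=
  integrable_of_continuous μ (hf.mul hg)

/-- The Cauchy transform of `g` with respect to `μ`. -/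
noncomputable def cauchy (μ : Measure UnitCircle) (g : UnitCircle → ℂ) (z : ℂ) : ℂ :=
  ∫ τ : UnitCircle, g τ / ((τ : ℂ) - z) ∂μ

theorem half_le_norm_sub {z : ℂ} (hz : ‖z‖ < 1 / 2) (τ : UnitCircle) : 1 / 2 ≤ ‖(τ : ℂ) - z‖ := by
  have h1 : ‖(τ : ℂ)‖ = 1 := by simp
  have h2 := norm_sub_norm_le (τ : ℂ) z
  linarith

theorem sub_ne_zero_of_norm_lt {z : ℂ} (hz : ‖z‖ < 1 / 2) (τ : UnitCircle) : (τ : ℂ) - z ≠ 0 := by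
  intro h
  have := half_le_norm_sub hz τ
  rw [h, norm_zero] at this
  linarith

theorem continuous_div_sub {g : UnitCircle → ℂ} (hg : Continuous g) {z : ℂ} (hz : ‖z‖ < 1 / 2) :
    Continuous fun τ : UnitCircle => g τ / ((τ : ℂ) - z) :=
  hg.div (continuous_subtype_val.sub continuous_const) (sub_ne_zero_of_norm_lt hz)

theorem eventually_norm_lt_half : ∀ᶠ z : ℂ in 𝓝 0, ‖z‖ < 1 / 2 := by
  have := Metric.ball_mem_nhds (0 : ℂ) (by norm_num : (0 : ℝ) < 1 / 2)
  filter_upwards [this] with z hz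
  simpa using hz

/-- The kernel is bounded by 2 when |z| < 1/2, so dominated convergence applies. Continuity at the
single point 0 is all that filling in the removable singularities requires; analyticity is never
used. -/
theorem continuousAt_cauchy (μ : Measure UnitCircle) [IsFiniteMeasure μ] {g : UnitCircle → ℂ}
    (hg : Continuous g) : ContinuousAt (cauchy μ g) 0 := by
  refine continuousAt_of_dominated (bound := fun τ => 2 * ‖g τ‖) ?_ ?_ ?_ ?_
  · filter_upwards [eventually_norm_lt_half] with z hz
    exact (continuous_div_sub hg hz).aestronglyMeasurable
  · filter_upwards [eventually_norm_lt_half] with z hz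
    refine Eventually.of_forall fun τ => ?_
    have h := half_le_norm_sub hz τ
    rw [norm_div, div_le_iff₀ (by linarith)]
    nlinarith [norm_nonneg (g τ)]
  · exact (integrable_of_continuous μ hg.norm).const_mul 2
  · refine Eventually.of_forall fun τ => ?_
    have := ne_zero_of_mem_circle τ
    exact continuousAt_const.div (continuousAt_const.sub continuousAt_id) (by simpa using this)

theorem cauchy_zero (μ : Measure UnitCircle) (g : UnitCircle → ℂ) :
    cauchy μ g 0 = ∫ τ, g τ * character (-1) τ ∂μ := by
  simp [cauchy, character, div_eq_mul_inv]

/-- If `h` vanishes at `0` and equals `z * k z` near `0` with `k` continuous, then `dslope h 0`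
equals `k` near `0`. -/
theorem dslope_eventuallyEq {h k : ℂ → ℂ} (h0 : h 0 = 0) (hk : ContinuousAt k 0)
    (hhk : ∀ᶠ z in 𝓝 0, h z = z * k z) : ∀ᶠ z in 𝓝 0, dslope h 0 z = k z := by
  filter_upwards [hhk] with z hz
  rcases eq_or_ne z 0 with rfl | hz0
  · rw [dslope_same]
    refine HasDerivAt.deriv ?_
    rw [hasDerivAt_iff_tendsto_slope]
    refine (hk.tendsto.mono_left nhdsWithin_le_nhds).congr' ?_
    filter_upwards [nhdsWithin_le_nhds hhk, self_mem_nhdsWithin] with w hw hw0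
    have hw0 : w ≠ 0 := hw0
    rw [slope_def_field, hw, h0]
    field_simp
    simp
  · rw [dslope_of_ne _ hz0, slope_def_field, hz, h0, sub_zero, sub_zero, mul_div_cancel_left₀ _ hz0]

/-! ### The Schur algorithm on quotients of Cauchy transforms. -/

/-- `f` agrees near `0` with the quotient of Cauchy transforms attached to an orthogonal
polynomial `φ` of degree `n`. -/
def IsCauchyQuotient (μ : Measure UnitCircle) (n : ℕ) (φ : UnitCircle → ℂ) (f : ℂ → ℂ) : Prop :=
  ∀ᶠ z in 𝓝 0, f z = cauchy μ (fun τ => conj (φ τ)) z /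
    cauchy μ (fun τ => φ τ * character (1 - n) τ) z

/-- With p = C[τ] and q = C[1], splitting the kernels gives F = p + zq and 1 = p - zq, so (F - 1)/(F
+ 1) = zq/p. -/
theorem isCauchyQuotient_schurFunction (μ : Measure UnitCircle) [IsProbabilityMeasure μ] :
    IsCauchyQuotient μ 0 (fun _ => 1) (schurFunction μ) := by
  have hc1 : Continuous fun _ : UnitCircle => conj (1 : ℂ) := continuous_const
  have hcp : Continuous fun τ : UnitCircle => (1 : ℂ) * character (1 - (0 : ℕ)) τ :=
    continuous_const.mul (continuous_character _)
  have hp0 : cauchy μ (fun τ : UnitCircle => (1 : ℂ) * character (1 - (0 : ℕ)) τ) 0 ≠ 0 := by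
    rw [cauchy_zero]
    simp [← character_add, character_zero]
  refine dslope_eventuallyEq ?_ ((continuousAt_cauchy μ hc1).div (continuousAt_cauchy μ hcp) hp0) ?_
  · simp [caratheodory_zero]
  · filter_upwards [eventually_norm_lt_half, (continuousAt_cauchy μ hcp).eventually_ne hp0]
      with z hz hpz
    have hi1 := integrable_of_continuous μ (continuous_div_sub hc1 hz)
    have hip := integrable_of_continuous μ (continuous_div_sub hcp hz)
    have hF : caratheodory μ z =
        cauchy μ (fun τ : UnitCircle => (1 : ℂ) * character (1 - (0 : ℕ)) τ) z
          + z * cauchy μ (fun _ => conj (1 : ℂ)) z := by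
      unfold caratheodory cauchy
      rw [← integral_const_mul, ← integral_add hip (hi1.const_mul z)]
      refine integral_congr_ae (Eventually.of_forall fun τ => ?_)
      have := sub_ne_zero_of_norm_lt hz τ
      simp [character_one]
      field_simp
    have h1 : (1 : ℂ) =
        cauchy μ (fun τ : UnitCircle => (1 : ℂ) * character (1 - (0 : ℕ)) τ) z
          - z * cauchy μ (fun _ => conj (1 : ℂ)) z := by
      unfold cauchy
      rw [← integral_const_mul, ← integral_sub hip (hi1.const_mul z)]
      trans ∫ _ : UnitCircle, (1 : ℂ) ∂μ
      · simp
      refine integral_congr_ae (Eventually.of_forall fun τ => ?_)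
      have := sub_ne_zero_of_norm_lt hz τ
      simp [character_one]
      field_simp
    generalize cauchy μ (fun τ : UnitCircle => (1 : ℂ) * character (1 - (0 : ℕ)) τ) z = p at *
    generalize cauchy μ (fun _ => conj (1 : ℂ)) z = q at *
    rw [hF]
    have e1 : p + z * q - 1 = 2 * (z * q) := by linear_combination -h1
    have e2 : p + z * q + 1 = 2 * p := by linear_combination h1
    rw [e1, e2]
    field_simp

/-- For f = q/p the recursion for ψ turns the denominator into p - conj(γ) q and z times the
numerator into q - γp, which is the Schur step. Orthogonality plays no role here; the integral
hypotheses only say that the denominators are nonzero at 0. -/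
theorem IsCauchyQuotient.schurStep {μ : Measure UnitCircle} [IsProbabilityMeasure μ] {n : ℕ}
    {φ ψ : UnitCircle → ℂ} {f : ℂ → ℂ} (h : IsCauchyQuotient μ n φ f)
    (hφ : Continuous φ) (hψ : Continuous ψ)
    (hφ0 : ∫ τ, φ τ * character (-n) τ ∂μ ≠ 0)
    (hψ0 : ∫ τ, ψ τ * character (-(n + 1 : ℕ)) τ ∂μ ≠ 0)
    (hφψ : ∀ᵐ τ ∂μ, ψ τ = character 1 τ * φ τ - conj (f 0) * (character n τ * conj (φ τ))) :
    IsCauchyQuotient μ (n + 1) ψ (schurStep f) := by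
  have hcq : Continuous fun τ => conj (φ τ) := Complex.continuous_conj.comp hφ
  have hcp : Continuous fun τ => φ τ * character (1 - n) τ := hφ.mul (continuous_character _)
  have hcq' : Continuous fun τ => conj (ψ τ) := Complex.continuous_conj.comp hψ
  have hcp' : Continuous fun τ => ψ τ * character (1 - (n + 1 : ℕ)) τ :=
    hψ.mul (continuous_character _)
  have hp0 : cauchy μ (fun τ => φ τ * character (1 - n) τ) 0 ≠ 0 := by
    rw [cauchy_zero]
    simp_rw [mul_assoc, ← character_add]
    convert hφ0 using 5
    ring
  have hp0' : cauchy μ (fun τ => ψ τ * character (1 - (n + 1 : ℕ)) τ) 0 ≠ 0 := by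
    rw [cauchy_zero]
    simp_rw [mul_assoc, ← character_add]
    convert hψ0 using 5
    ring
  have hf0 := h.self_of_nhds
  rw [eq_div_iff hp0] at hf0
  refine dslope_eventuallyEq (by simp)
    ((continuousAt_cauchy μ hcq').div (continuousAt_cauchy μ hcp') hp0') ?_
  filter_upwards [h, eventually_norm_lt_half, (continuousAt_cauchy μ hcp).eventually_ne hp0,
    (continuousAt_cauchy μ hcp').eventually_ne hp0'] with z hfz hz hpz hpz'
  have hz0 : ‖(0 : ℂ)‖ < 1 / 2 := by norm_num
  have hiq := integrable_of_continuous μ (continuous_div_sub hcq hz)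
  have hip := integrable_of_continuous μ (continuous_div_sub hcp hz)
  have hiq0 := integrable_of_continuous μ (continuous_div_sub hcq hz0)
  have hip0 := integrable_of_continuous μ (continuous_div_sub hcp hz0)
  have hP : cauchy μ (fun τ => ψ τ * character (1 - (n + 1 : ℕ)) τ) z =
      cauchy μ (fun τ => φ τ * character (1 - n) τ) z
        - conj (f 0) * cauchy μ (fun τ => conj (φ τ)) z := by
    unfold cauchy
    rw [← integral_const_mul, ← integral_sub hip (hiq.const_mul _)]
    refine integral_congr_ae ?_
    filter_upwards [hφψ] with τ hτ
    have e1 : character (1 - (n + 1 : ℕ)) τ = character (-n) τ := by congr 1; push_cast; ring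
    have e2 : character 1 τ * character (-n) τ = character (1 - n) τ := by
      rw [← character_add]; rfl
    have e3 : character n τ * character (-n) τ = 1 := by
      rw [← character_add, add_neg_cancel, character_zero]
    rw [hτ, e1, ← mul_div_assoc, ← sub_div]
    congr 1
    linear_combination φ τ * e2 - conj (f 0) * conj (φ τ) * e3
  -- The integrand identity is z/(τ(τ - z)) = 1/(τ - z) - 1/τ; the second term produces the values
  -- at 0.
  have hQ : z * cauchy μ (fun τ => conj (ψ τ)) z =
      (cauchy μ (fun τ => conj (φ τ)) z - f 0 * cauchy μ (fun τ => φ τ * character (1 - n) τ) z)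
      - (cauchy μ (fun τ => conj (φ τ)) 0
        - f 0 * cauchy μ (fun τ => φ τ * character (1 - n) τ) 0) := by
    have hd : Integrable (fun τ : UnitCircle => conj (φ τ) / ((τ : ℂ) - z)
        - f 0 * (φ τ * character (1 - n) τ / ((τ : ℂ) - z))) μ := hiq.sub (hip.const_mul _)
    have hd0 : Integrable (fun τ : UnitCircle => conj (φ τ) / ((τ : ℂ) - 0)
        - f 0 * (φ τ * character (1 - n) τ / ((τ : ℂ) - 0))) μ := hiq0.sub (hip0.const_mul _)
    unfold cauchy
    rw [← integral_const_mul, ← integral_const_mul, ← integral_const_mul,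
      ← integral_sub hiq (hip.const_mul _), ← integral_sub hiq0 (hip0.const_mul _),
      ← integral_sub hd hd0]
    refine integral_congr_ae ?_
    filter_upwards [hφψ] with τ hτ
    have e2 : character (1 - n) τ = τ * character (-n) τ := by
      rw [sub_eq_add_neg, character_add, character_one]
    have e4 : conj (τ : ℂ) = (τ : ℂ)⁻¹ := by
      have := conj_character 1 τ
      rw [character_one] at this
      rw [this]; simp [character]
    have hne := sub_ne_zero_of_norm_lt hz τ
    have hne0 := ne_zero_of_mem_circle τ
    simp only [hτ, map_sub, map_mul, Complex.conj_conj, conj_character, e2, character_one, e4,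
      sub_zero]
    field_simp
    ring
  -- The correction at 0 vanishes precisely because γ = f(0) = q(0)/p(0).
  have hQ' : z * cauchy μ (fun τ => conj (ψ τ)) z =
      cauchy μ (fun τ => conj (φ τ)) z - f 0 * cauchy μ (fun τ => φ τ * character (1 - n) τ) z := by
    rw [hQ, ← hf0]; ring
  rw [← mul_div_assoc, hQ', hP, hfz]
  rw [hP] at hpz'
  generalize cauchy μ (fun τ => φ τ * character (1 - n) τ) z = p at *
  generalize cauchy μ (fun τ => conj (φ τ)) z = q at *
  have h2 : 1 - conj (f 0) * (q / p) = (p - conj (f 0) * q) / p := by field_simp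
  have h3 : q / p - f 0 = (q - f 0 * p) / p := by field_simp
  rw [h2, h3, div_div_div_cancel_right₀ hpz]

theorem IsCauchyQuotient.apply_zero {μ : Measure UnitCircle} {n : ℕ}
    {φ : UnitCircle → ℂ} {f : ℂ → ℂ} (h : IsCauchyQuotient μ n φ f) :
    f 0 = (∫ τ, conj (φ τ) * character (-1) τ ∂μ) / ∫ τ, φ τ * character (-n) τ ∂μ := by
  have := h.self_of_nhds
  rw [this, cauchy_zero, cauchy_zero]
  simp_rw [mul_assoc, ← character_add]
  congr 6
  ext τ
  congr 2
  ring

/-! ### Cosine and sine modes in terms of characters. -/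

theorem ofReal_cosMode (n : ℕ) (τ : UnitCircle) :
    (cosMode n τ : ℂ) = (character n τ + character (-n) τ) / 2 := by
  rw [coe_cosMode]; simp [character]

theorem ofReal_sinMode (n : ℕ) (τ : UnitCircle) :
    (sinMode n τ : ℂ) = (character n τ - character (-n) τ) / (2 * Complex.I) := by
  rw [coe_sinMode]; simp [character]

theorem character_eq_cosMode_add (n : ℕ) (τ : UnitCircle) :
    character n τ = cosMode n τ + Complex.I * sinMode n τ := by
  rw [ofReal_cosMode, ofReal_sinMode]
  have := Complex.I_ne_zero
  field_simp
  ring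

theorem continuous_of_ofReal {f : UnitCircle → ℝ} (hf : Continuous fun τ => (f τ : ℂ)) :
    Continuous f :=
  (Complex.continuous_re.comp hf).congr fun τ => Complex.ofReal_re (f τ)

theorem continuous_cosMode (n : ℕ) : Continuous (cosMode n) := by
  apply continuous_of_ofReal
  simp_rw [ofReal_cosMode]
  exact ((continuous_character _).add (continuous_character _)).div_const _

theorem continuous_sinMode (n : ℕ) : Continuous (sinMode n) := by
  apply continuous_of_ofReal
  simp_rw [ofReal_sinMode]
  exact ((continuous_character _).sub (continuous_character _)).div_const _

theorem continuous_trigSystem (k : ℕ) : Continuous (trigSystem k) := by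
  unfold trigSystem
  split_ifs
  · exact continuous_cosMode _
  · exact continuous_sinMode _

theorem trigSystem_two_mul (n : ℕ) : trigSystem (2 * n) = cosMode n := by
  simp [trigSystem]

theorem trigSystem_two_mul_add_one (n : ℕ) : trigSystem (2 * n + 1) = sinMode (n + 1) := by
  have h : (2 * n + 1 + 1) / 2 = n + 1 := by omega
  simp [trigSystem, h]

/-! ### Orthogonality of the Gram–Schmidt functions. -/

/-- The coefficient of `monicOTP μ j` in the Gram–Schmidt expansion of `trigSystem k`. -/
noncomputable def gsCoeff (μ : Measure UnitCircle) (k j : ℕ) : ℝ :=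
  realInner μ (trigSystem k) (monicOTP μ j) / realInner μ (monicOTP μ j) (monicOTP μ j)

theorem monicOTP_apply (μ : Measure UnitCircle) (k : ℕ) (τ : UnitCircle) :
    monicOTP μ k τ =
      trigSystem k τ - ∑ j ∈ Finset.range k, gsCoeff μ k j * monicOTP μ j τ := by
  rw [monicOTP, Finset.sum_range]
  rfl

theorem trigSystem_eq (μ : Measure UnitCircle) (k : ℕ) (τ : UnitCircle) :
    trigSystem k τ =
      monicOTP μ k τ + ∑ j ∈ Finset.range k, gsCoeff μ k j * monicOTP μ j τ := by
  rw [monicOTP_apply]; ring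

theorem continuous_monicOTP (μ : Measure UnitCircle) (k : ℕ) : Continuous (monicOTP μ k) := by
  induction k using Nat.strong_induction_on with
  | _ k ih =>
    rw [funext (monicOTP_apply μ k)]
    exact (continuous_trigSystem k).sub (continuous_finsetSum _ fun j hj =>
      (ih j (Finset.mem_range.1 hj)).const_mul _)

theorem realInner_comm (μ : Measure UnitCircle) (f g : UnitCircle → ℝ) :
    realInner μ f g = realInner μ g f := by
  simp_rw [realInner, mul_comm]

theorem realInner_add_sum_left (μ : Measure UnitCircle) [IsFiniteMeasure μ]
    {f g : UnitCircle → ℝ} (hf : Continuous f) (hg : Continuous g) (s : Finset ℕ) (c : ℕ → ℝ)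
    (F : ℕ → UnitCircle → ℝ) (hF : ∀ j, Continuous (F j)) :
    realInner μ (fun τ => f τ + ∑ j ∈ s, c j * F j τ) g =
      realInner μ f g + ∑ j ∈ s, c j * realInner μ (F j) g := by
  unfold realInner
  simp_rw [add_mul, Finset.sum_mul, mul_assoc]
  rw [integral_add, integral_finsetSum]
  · simp_rw [integral_const_mul]
  · exact fun j _ => (integrable_of_continuous μ ((hF j).mul hg)).const_mul _
  · exact integrable_of_continuous μ (hf.mul hg)
  · exact integrable_finsetSum _ fun j _ =>
      (integrable_of_continuous μ ((hF j).mul hg)).const_mul _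

/-- Strong induction: pairing the expansion with an earlier function leaves one term of the sum,
which cancels the leading one. Nonzero norms are needed since a coefficient with zero denominator
would be 0. -/
theorem realInner_monicOTP_of_lt (μ : Measure UnitCircle) [IsFiniteMeasure μ]
    (hne : ∀ k, realInner μ (monicOTP μ k) (monicOTP μ k) ≠ 0) (k : ℕ) :
    ∀ j < k, realInner μ (monicOTP μ k) (monicOTP μ j) = 0 := by
  induction k using Nat.strong_induction_on with
  | _ k ih =>
    intro j hj
    have hM : monicOTP μ k = fun τ =>
        trigSystem k τ + ∑ i ∈ Finset.range k, (-gsCoeff μ k i) * monicOTP μ i τ := by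
      funext τ
      rw [monicOTP_apply]
      simp [sub_eq_add_neg]
    rw [hM, realInner_add_sum_left μ (continuous_trigSystem k) (continuous_monicOTP μ j) _ _ _
      (continuous_monicOTP μ), Finset.sum_eq_single j]
    · rw [gsCoeff, neg_mul, div_mul_cancel₀ _ (hne j), add_neg_cancel]
    · intro i hi hij
      rw [Finset.mem_range] at hi
      rcases lt_or_gt_of_ne hij with h | h
      · rw [realInner_comm, ih j hj i h, mul_zero]
      · rw [ih i hi j h, mul_zero]
    · exact fun h => absurd (Finset.mem_range.2 hj) h

theorem realInner_trigSystem_monicOTP_of_lt (μ : Measure UnitCircle) [IsFiniteMeasure μ]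
    (hne : ∀ k, realInner μ (monicOTP μ k) (monicOTP μ k) ≠ 0) {j k : ℕ} (hjk : j < k) :
    realInner μ (trigSystem j) (monicOTP μ k) = 0 := by
  rw [funext (trigSystem_eq μ j), realInner_add_sum_left μ (continuous_monicOTP μ j)
    (continuous_monicOTP μ k) _ _ _ (continuous_monicOTP μ), realInner_comm,
    realInner_monicOTP_of_lt μ hne k j hjk, zero_add]
  refine Finset.sum_eq_zero fun i hi => ?_
  rw [realInner_comm, realInner_monicOTP_of_lt μ hne k i ((Finset.mem_range.1 hi).trans hjk),
    mul_zero]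

theorem realInner_trigSystem_monicOTP_self (μ : Measure UnitCircle) [IsFiniteMeasure μ]
    (hne : ∀ k, realInner μ (monicOTP μ k) (monicOTP μ k) ≠ 0) (k : ℕ) :
    realInner μ (trigSystem k) (monicOTP μ k) = realInner μ (monicOTP μ k) (monicOTP μ k) := by
  rw [funext (trigSystem_eq μ k), realInner_add_sum_left μ (continuous_monicOTP μ k)
    (continuous_monicOTP μ k) _ _ _ (continuous_monicOTP μ), add_eq_left]
  refine Finset.sum_eq_zero fun i hi => ?_
  rw [realInner_comm, realInner_monicOTP_of_lt μ hne k i (Finset.mem_range.1 hi), mul_zero]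

/-! ### Trigonometric polynomials and nondegeneracy for infinite support. -/

/-- Trigonometric polynomials of degree at most `m`. -/
noncomputable def trigPoly (m : ℕ) : Submodule ℂ (UnitCircle → ℂ) :=
  Submodule.span ℂ (character '' Set.Icc (-m) m)

theorem character_mem_trigPoly {m : ℕ} {j : ℤ} (h1 : -m ≤ j) (h2 : j ≤ m) :
    character j ∈ trigPoly m :=
  Submodule.subset_span ⟨j, ⟨h1, h2⟩, rfl⟩

theorem trigPoly_mono {m n : ℕ} (h : m ≤ n) : trigPoly m ≤ trigPoly n := by
  refine Submodule.span_mono (Set.image_mono (Set.Icc_subset_Icc ?_ ?_)) <;> omega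

theorem trigPoly_induction {m : ℕ} {p : (UnitCircle → ℂ) → Prop}
    (hc : ∀ j : ℤ, -m ≤ j → j ≤ m → p (character j)) (h0 : p 0)
    (hadd : ∀ f g, f ∈ trigPoly m → g ∈ trigPoly m → p f → p g → p (f + g))
    (hsmul : ∀ (c : ℂ) f, f ∈ trigPoly m → p f → p (c • f)) {f : UnitCircle → ℂ}
    (hf : f ∈ trigPoly m) : p f := by
  refine Submodule.span_induction (p := fun f _ => p f) ?_ h0 (fun f g hf hg => hadd f g hf hg)
    (fun c f hf => hsmul c f hf) hf
  rintro _ ⟨j, hj, rfl⟩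
  exact hc j hj.1 hj.2

theorem continuous_of_mem_trigPoly {m : ℕ} {f : UnitCircle → ℂ} (hf : f ∈ trigPoly m) :
    Continuous f :=
  trigPoly_induction (fun j _ _ => continuous_character j) continuous_const
    (fun _ _ _ _ h1 h2 => h1.add h2) (fun c _ _ h => h.const_smul c) hf

theorem conj_mem_trigPoly {m : ℕ} {f : UnitCircle → ℂ} (hf : f ∈ trigPoly m) :
    (fun τ => conj (f τ)) ∈ trigPoly m := by
  refine trigPoly_induction (p := fun f => (fun τ => conj (f τ)) ∈ trigPoly m)
    ?_ ?_ ?_ ?_ hf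
  · intro j h1 h2
    simp_rw [conj_character]
    exact character_mem_trigPoly (by omega) (by omega)
  · simp_rw [Pi.zero_apply, map_zero]
    exact (trigPoly m).zero_mem
  · intro f g _ _ h1 h2
    simp_rw [Pi.add_apply, map_add]
    exact (trigPoly m).add_mem h1 h2
  · intro c f _ h
    simp_rw [Pi.smul_apply, smul_eq_mul, map_mul]
    exact (trigPoly m).smul_mem (conj c) h

theorem character_mul_mem_trigPoly {m : ℕ} {f : UnitCircle → ℂ} (hf : f ∈ trigPoly m) :
    (fun τ => character 1 τ * f τ) ∈ trigPoly (m + 1) := by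
  refine trigPoly_induction (p := fun f => (fun τ => character 1 τ * f τ) ∈ trigPoly (m + 1))
    ?_ ?_ ?_ ?_ hf
  · intro j h1 h2
    simp_rw [← character_add]
    exact character_mem_trigPoly (by push_cast; omega) (by push_cast; omega)
  · simp_rw [Pi.zero_apply, mul_zero]
    exact (trigPoly (m + 1)).zero_mem
  · intro f g _ _ h1 h2
    simp only [Pi.add_apply, mul_add]
    exact (trigPoly (m + 1)).add_mem h1 h2
  · intro c f _ h
    simp only [Pi.smul_apply, mul_smul_comm]
    exact (trigPoly (m + 1)).smul_mem c h

theorem cosMode_mem_trigPoly (n : ℕ) : (fun τ => (cosMode n τ : ℂ)) ∈ trigPoly n := by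
  simp_rw [ofReal_cosMode, add_div, div_eq_inv_mul]
  exact add_mem (Submodule.smul_mem _ _ (character_mem_trigPoly (by omega) le_rfl))
    (Submodule.smul_mem _ _ (character_mem_trigPoly le_rfl (by omega)))

theorem sinMode_mem_trigPoly (n : ℕ) : (fun τ => (sinMode n τ : ℂ)) ∈ trigPoly n := by
  simp_rw [ofReal_sinMode, sub_div, div_eq_inv_mul]
  exact sub_mem (Submodule.smul_mem _ _ (character_mem_trigPoly (by omega) le_rfl))
    (Submodule.smul_mem _ _ (character_mem_trigPoly le_rfl (by omega)))

theorem trigSystem_mem_trigPoly {k m : ℕ} (h : k ≤ 2 * m) :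
    (fun τ => (trigSystem k τ : ℂ)) ∈ trigPoly m := by
  unfold trigSystem
  split_ifs with hk
  · exact trigPoly_mono (by omega) (cosMode_mem_trigPoly _)
  · have : ¬ k = 2 * m := fun h => hk (by simp [h])
    exact trigPoly_mono (by omega) (sinMode_mem_trigPoly _)

theorem ofReal_sum_mem {V : Submodule ℂ (UnitCircle → ℂ)} {s : Finset ℕ} {c : ℕ → ℝ}
    {F : ℕ → UnitCircle → ℝ} (hF : ∀ j ∈ s, (fun τ => (F j τ : ℂ)) ∈ V) :
    (fun τ => ((∑ j ∈ s, c j * F j τ : ℝ) : ℂ)) ∈ V := by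
  have : (fun τ => ((∑ j ∈ s, c j * F j τ : ℝ) : ℂ)) =
      ∑ j ∈ s, (c j : ℂ) • fun τ => (F j τ : ℂ) := by
    funext τ
    simp
  rw [this]
  exact V.sum_mem fun j hj => V.smul_mem _ (hF j hj)

theorem monicOTP_mem_trigPoly (μ : Measure UnitCircle) {k m : ℕ} (h : k ≤ 2 * m) :
    (fun τ => (monicOTP μ k τ : ℂ)) ∈ trigPoly m := by
  induction k using Nat.strong_induction_on with
  | _ k ih =>
    simp_rw [monicOTP_apply μ k, Complex.ofReal_sub]
    exact sub_mem (trigSystem_mem_trigPoly h) (ofReal_sum_mem fun j hj =>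
      ih j (Finset.mem_range.1 hj) (by have := Finset.mem_range.1 hj; omega))

/-- Multiplication by `τ ^ m` turns a trigonometric polynomial into a polynomial. -/
theorem exists_polynomial_of_mem_trigPoly {m : ℕ} {f : UnitCircle → ℂ} (hf : f ∈ trigPoly m) :
    ∃ Q : Polynomial ℂ, Q.natDegree ≤ 2 * m ∧ ∀ τ, character m τ * f τ = Q.eval (τ : ℂ) := by
  refine trigPoly_induction (p := fun f => ∃ Q : Polynomial ℂ, Q.natDegree ≤ 2 * m ∧
    ∀ τ, character m τ * f τ = Q.eval (τ : ℂ)) ?_ ?_ ?_ ?_ hf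
  · intro j h1 h2
    refine ⟨Polynomial.X ^ (m + j).toNat, ?_, fun τ => ?_⟩
    · rw [Polynomial.natDegree_X_pow]; omega
    · rw [← character_add, Polynomial.eval_pow, Polynomial.eval_X, character, ← zpow_natCast,
        Int.toNat_of_nonneg (by omega)]
  · exact ⟨0, by simp, fun τ => by simp⟩
  · rintro f g _ _ ⟨P, hP, hP'⟩ ⟨Q, hQ, hQ'⟩
    refine ⟨P + Q, Polynomial.natDegree_add_le_of_degree_le hP hQ, fun τ => ?_⟩
    rw [Pi.add_apply, mul_add, hP', hQ', Polynomial.eval_add]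
  · rintro c f _ ⟨P, hP, hP'⟩
    refine ⟨Polynomial.C c * P, (Polynomial.natDegree_C_mul_le _ _).trans hP, fun τ => ?_⟩
    rw [Pi.smul_apply, smul_eq_mul, mul_left_comm, hP', Polynomial.eval_C_mul]

/-- A continuous function that is nonzero at a support point is nonzero on a neighbourhood of
positive measure, so the zero set contains the support. -/
theorem infinite_of_support_infinite {μ : Measure UnitCircle} (hμ : μ.support.Infinite)
    {f : UnitCircle → ℂ} (hf : Continuous f) (h0 : f =ᵐ[μ] 0) : {τ | f τ = 0}.Infinite := by
  refine hμ.mono fun τ hτ => ?_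
  by_contra hne
  have hU : {τ | f τ ≠ 0} ∈ 𝓝 τ := (isOpen_ne_fun hf continuous_const).mem_nhds hne
  rw [Measure.mem_support_iff_forall] at hτ
  exact (hτ _ hU).ne' (ae_iff.1 h0)

/-- A trigonometric polynomial with nonzero leading coefficient does not vanish almost
everywhere for a measure of infinite support. -/
theorem not_ae_zero {μ : Measure UnitCircle} (hμ : μ.support.Infinite) {m : ℕ} {c c' : ℂ}
    (hc : c ≠ 0) {f g : UnitCircle → ℂ} (hf : f ∈ trigPoly m)
    (hg : ∀ τ, g τ = c * character (m + 1 : ℕ) τ + c' * character (-(m + 1 : ℕ)) τ + f τ) :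
    ¬ g =ᵐ[μ] 0 := by
  intro h0
  obtain ⟨Q, hQ, hQ'⟩ := exists_polynomial_of_mem_trigPoly hf
  have hgc : Continuous g := by
    rw [funext hg]
    exact (((continuous_character _).const_mul c).add ((continuous_character _).const_mul c')).add
      (continuous_of_mem_trigPoly hf)
  have hinf := infinite_of_support_infinite hμ hgc h0
  -- P is τ^(m+1) g: the three terms become cτ^(2m+2), c' and τQ, so the top coefficient is c while
  -- P vanishes on an infinite set.
  set P : Polynomial ℂ := Polynomial.C c * Polynomial.X ^ (2 * (m + 1)) +
    (Polynomial.C c' + Polynomial.X * Q) with hP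
  have hcoeff : P.coeff (2 * (m + 1)) = c := by
    have h1 : (Polynomial.C c' + Polynomial.X * Q).natDegree < 2 * (m + 1) := by
      refine lt_of_le_of_lt (Polynomial.natDegree_add_le_of_degree_le (n := 2 * m + 1) (by simp)
        ((Polynomial.natDegree_mul_le).trans ?_)) (by omega)
      rw [Polynomial.natDegree_X]; omega
    rw [hP, Polynomial.coeff_add, Polynomial.coeff_C_mul_X_pow,
      Polynomial.coeff_eq_zero_of_natDegree_lt h1]
    simp
  have hPne : P ≠ 0 := fun h => hc (by rw [← hcoeff, h, Polynomial.coeff_zero])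
  refine (hinf.image (Subtype.val_injective.injOn)) ((P.rootSet_finite ℂ).subset ?_)
  rintro _ ⟨τ, hτ, rfl⟩
  rw [Polynomial.mem_rootSet]
  refine ⟨hPne, ?_⟩
  have hτ : g τ = 0 := hτ
  have e1 : (τ : ℂ) * Q.eval (τ : ℂ) = character (m + 1 : ℕ) τ * f τ := by
    rw [← hQ', Nat.cast_add, character_add, Nat.cast_one, character_one]; ring
  have e2 : (τ : ℂ) ^ (2 * (m + 1)) = character (m + 1 : ℕ) τ * character (m + 1 : ℕ) τ := by
    rw [two_mul, pow_add]; simp only [character, zpow_natCast]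
  have e3 : character (m + 1 : ℕ) τ * character (-(m + 1 : ℕ)) τ = 1 := by
    rw [← character_add, add_neg_cancel, character_zero]
  rw [hP, Polynomial.aeval_def, Algebra.algebraMap_self, Polynomial.eval₂_id]
  simp only [Polynomial.eval_add, Polynomial.eval_mul, Polynomial.eval_C, Polynomial.eval_pow,
    Polynomial.eval_X]
  rw [e1, e2]
  have := hg τ
  rw [hτ] at this
  linear_combination -character (m + 1 : ℕ) τ * this - c' * e3

theorem monicOTP_odd (μ : Measure UnitCircle) (m : ℕ) :
    ∃ f ∈ trigPoly m, ∀ τ, (monicOTP μ (2 * m + 1) τ : ℂ) = sinMode (m + 1) τ + f τ := by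
  refine ⟨_, neg_mem (ofReal_sum_mem (s := Finset.range (2 * m + 1)) (c := gsCoeff μ (2 * m + 1))
    (F := monicOTP μ) fun j hj => monicOTP_mem_trigPoly μ (m := m) ?_), fun τ => ?_⟩
  · have := Finset.mem_range.1 hj; omega
  · rw [monicOTP_apply, trigSystem_two_mul_add_one, Complex.ofReal_sub, Pi.neg_apply]; ring

/-- The preceding sine function also has degree m + 1, so its term cannot be absorbed into the
lower-degree remainder. -/
theorem monicOTP_even (μ : Measure UnitCircle) (m : ℕ) :
    ∃ f ∈ trigPoly m, ∀ τ, (monicOTP μ (2 * m + 2) τ : ℂ) = cosMode (m + 1) τ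
      - gsCoeff μ (2 * m + 2) (2 * m + 1) * monicOTP μ (2 * m + 1) τ + f τ := by
  refine ⟨_, neg_mem (ofReal_sum_mem (s := Finset.range (2 * m + 1)) (c := gsCoeff μ (2 * m + 2))
    (F := monicOTP μ) fun j hj => monicOTP_mem_trigPoly μ (m := m) ?_), fun τ => ?_⟩
  · have := Finset.mem_range.1 hj; omega
  · rw [monicOTP_apply, show 2 * m + 2 = 2 * (m + 1) by ring, trigSystem_two_mul,
      show 2 * (m + 1) = 2 * m + 1 + 1 by ring, Finset.sum_range_succ, Complex.ofReal_sub,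
      Complex.ofReal_add, Complex.ofReal_mul, Pi.neg_apply]; ring

theorem monicOTP_not_ae_zero {μ : Measure UnitCircle} [IsProbabilityMeasure μ]
    (hμ : μ.support.Infinite) (k : ℕ) : ¬ (fun τ => (monicOTP μ k τ : ℂ)) =ᵐ[μ] 0 := by
  have hI := Complex.I_ne_zero
  rcases Nat.even_or_odd' k with ⟨n, rfl | rfl⟩
  · rcases n with _ | m
    · intro h
      obtain ⟨τ, hτ⟩ := h.exists
      have hτ : (monicOTP μ (2 * 0) τ : ℂ) = 0 := hτ
      rw [monicOTP_apply] at hτ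
      simp [trigSystem, cosMode] at hτ
    · obtain ⟨f, hf, h1⟩ := monicOTP_odd μ m
      obtain ⟨g, hg, h2⟩ := monicOTP_even μ m
      set t : ℝ := gsCoeff μ (2 * m + 2) (2 * m + 1)
      refine not_ae_zero (c := 1 / 2 - t / (2 * Complex.I)) (c' := 1 / 2 + t / (2 * Complex.I)) hμ
        ?_ (add_mem hg ((trigPoly m).smul_mem (-t : ℂ) hf)) (fun τ => ?_)
      · intro h
        -- A vanishing leading coefficient would force t = i, but t is real.
        have h3 : Complex.I - t = 0 := by
          field_simp at h
          linear_combination h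
        simpa using congrArg Complex.im h3
      · rw [show 2 * (m + 1) = 2 * m + 2 by ring, h2, h1, ofReal_cosMode, ofReal_sinMode,
          Pi.add_apply, Pi.smul_apply, smul_eq_mul]
        ring
  · obtain ⟨f, hf, h1⟩ := monicOTP_odd μ n
    refine not_ae_zero (c := 1 / (2 * Complex.I)) (c' := -1 / (2 * Complex.I)) hμ (by simp)
      hf (fun τ => ?_)
    rw [h1, ofReal_sinMode]
    ring

theorem ae_zero_of_integral_normSq {μ : Measure UnitCircle} [IsFiniteMeasure μ]
    {f : UnitCircle → ℂ} (hf : Continuous f) (h : ∫ τ, f τ * conj (f τ) ∂μ = 0) :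
    f =ᵐ[μ] 0 := by
  have h1 : ∫ τ, Complex.normSq (f τ) ∂μ = 0 := by
    simp_rw [Complex.mul_conj] at h
    rw [integral_complex_ofReal] at h
    exact_mod_cast h
  rw [integral_eq_zero_iff_of_nonneg (fun τ => Complex.normSq_nonneg _)
    (integrable_of_continuous μ (Complex.continuous_normSq.comp hf))] at h1
  filter_upwards [h1] with τ hτ
  exact Complex.normSq_eq_zero.1 hτ

theorem realInner_monicOTP_self_pos {μ : Measure UnitCircle} [IsProbabilityMeasure μ]
    (hμ : μ.support.Infinite) (k : ℕ) : 0 < realInner μ (monicOTP μ k) (monicOTP μ k) := by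
  refine lt_of_le_of_ne (integral_nonneg fun τ => mul_self_nonneg _) fun h => ?_
  refine monicOTP_not_ae_zero hμ k (ae_zero_of_integral_normSq
    (Complex.continuous_ofReal.comp (continuous_monicOTP μ k)) ?_)
  simp_rw [Complex.conj_ofReal, ← Complex.ofReal_mul]
  rw [integral_complex_ofReal]
  exact_mod_cast h.symm

theorem integral_mul_eq_zero_of_trigPoly {μ : Measure UnitCircle} [IsFiniteMeasure μ]
    {m : ℕ} {g : UnitCircle → ℂ} (hg : Continuous g)
    (h : ∀ j : ℤ, -m ≤ j → j ≤ m → ∫ τ, g τ * character j τ ∂μ = 0)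
    {f : UnitCircle → ℂ} (hf : f ∈ trigPoly m) : ∫ τ, g τ * f τ ∂μ = 0 := by
  refine trigPoly_induction (p := fun f => ∫ τ, g τ * f τ ∂μ = 0) h ?_ ?_ ?_ hf
  · simp
  · intro f₁ f₂ hf₁ hf₂ h₁ h₂
    simp only [Pi.add_apply, mul_add]
    rw [integral_add (integrable_mul_of_continuous μ hg (continuous_of_mem_trigPoly hf₁))
      (integrable_mul_of_continuous μ hg (continuous_of_mem_trigPoly hf₂)), h₁, h₂, add_zero]
  · intro c f _ h
    simp only [Pi.smul_apply, mul_smul_comm]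
    rw [integral_smul, h, smul_zero]

/-- A trigonometric polynomial orthogonal to all characters of its degree vanishes almost
everywhere. -/
theorem ae_zero_of_mem_trigPoly {μ : Measure UnitCircle} [IsFiniteMeasure μ] {m : ℕ}
    {f : UnitCircle → ℂ} (hf : f ∈ trigPoly m)
    (h : ∀ j : ℤ, -m ≤ j → j ≤ m → ∫ τ, f τ * character j τ ∂μ = 0) : f =ᵐ[μ] 0 :=
  -- Tested against its own conjugate, which has the same degree bound, f has zero norm.
  ae_zero_of_integral_normSq (continuous_of_mem_trigPoly hf)
    (integral_mul_eq_zero_of_trigPoly (continuous_of_mem_trigPoly hf) h (conj_mem_trigPoly hf))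

/-! ### Recursion coefficients as inner products and moments. -/

theorem a_succ_sq (μ : Measure UnitCircle) (m : ℕ) :
    a μ (m + 1) ^ 2 = realInner μ (monicOTP μ (2 * m + 2)) (monicOTP μ (2 * m + 2)) := by
  rw [a, realNorm, Real.sq_sqrt (integral_nonneg fun τ => sq_nonneg _)]
  simp_rw [sq_abs, pow_two]
  rfl

theorem b_succ_sq (μ : Measure UnitCircle) (m : ℕ) :
    b μ (m + 1) ^ 2 = realInner μ (monicOTP μ (2 * m + 1)) (monicOTP μ (2 * m + 1)) := by
  rw [b, realNorm, Real.sq_sqrt (integral_nonneg fun τ => sq_nonneg _)]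
  simp_rw [sq_abs, pow_two]
  rfl

/-- One factor c⁻¹ is explicit in the coefficients and one sits in the normalised function, so each
coefficient is an inner product with the unnormalised function divided by its squared norm. -/
theorem realInner_inv_mul_inv_mul (μ : Measure UnitCircle) (f g : UnitCircle → ℝ) (c : ℝ) :
    realInner μ f (fun τ => c⁻¹ * (c⁻¹ * g τ)) = realInner μ f g / c ^ 2 := by
  unfold realInner
  rw [← integral_div]
  congr 1
  funext τ
  rw [div_eq_mul_inv, ← inv_pow]
  ring

section Relations

variable {μ : Measure UnitCircle}

theorem gsCoeff_eq_beta (m : ℕ) :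
    gsCoeff μ (2 * m + 2) (2 * m + 1) = beta μ (m + 1) := by
  have h : beta μ (m + 1) = _ :=
    realInner_inv_mul_inv_mul μ (cosMode (m + 1)) (monicOTP μ (2 * m + 1)) (b μ (m + 1))
  rw [h, b_succ_sq, gsCoeff, show 2 * m + 2 = 2 * (m + 1) by ring, trigSystem_two_mul]

theorem integral_ofReal_mul_ofReal (f g : UnitCircle → ℝ) :
    ∫ τ, (f τ : ℂ) * (g τ : ℂ) ∂μ = realInner μ g f := by
  simp_rw [realInner, ← Complex.ofReal_mul, integral_complex_ofReal, mul_comm]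

theorem integral_conj_mul_character (f : UnitCircle → ℂ) (j : ℤ) :
    ∫ τ, conj (f τ) * character j τ ∂μ = conj (∫ τ, f τ * character (-j) τ ∂μ) := by
  rw [← integral_conj]
  simp_rw [map_mul, conj_character, neg_neg]

theorem integral_character_mul_mul (i j k : ℤ) (h : i + j = k) (f : UnitCircle → ℂ) :
    ∫ τ, character i τ * f τ * character j τ ∂μ = ∫ τ, f τ * character k τ ∂μ := by
  subst h
  simp_rw [character_add]
  congr 1
  funext τ
  ring

variable [IsProbabilityMeasure μ]

theorem a_succ_sq_pos (hμ : μ.support.Infinite) (m : ℕ) : 0 < a μ (m + 1) ^ 2 := by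
  rw [a_succ_sq]; exact realInner_monicOTP_self_pos hμ _

theorem b_succ_sq_pos (hμ : μ.support.Infinite) (m : ℕ) : 0 < b μ (m + 1) ^ 2 := by
  rw [b_succ_sq]; exact realInner_monicOTP_self_pos hμ _

theorem realInner_cosMode_odd (hμ : μ.support.Infinite) (m : ℕ) :
    realInner μ (cosMode (m + 1)) (monicOTP μ (2 * m + 1)) =
      beta μ (m + 1) * b μ (m + 1) ^ 2 := by
  have h : beta μ (m + 1) = _ :=
    realInner_inv_mul_inv_mul μ (cosMode (m + 1)) (monicOTP μ (2 * m + 1)) (b μ (m + 1))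
  rw [h, div_mul_cancel₀ _ (b_succ_sq_pos hμ m).ne']

theorem realInner_cosMode_add_two_even (hμ : μ.support.Infinite) (m : ℕ) :
    realInner μ (cosMode (m + 2)) (monicOTP μ (2 * m + 2)) =
      iota μ (m + 2) * a μ (m + 1) ^ 2 := by
  have h : iota μ (m + 2) = _ :=
    realInner_inv_mul_inv_mul μ (cosMode (m + 2)) (monicOTP μ (2 * m + 2)) (a μ (m + 1))
  rw [h, div_mul_cancel₀ _ (a_succ_sq_pos hμ m).ne']

theorem realInner_cosMode_add_two_odd (hμ : μ.support.Infinite) (m : ℕ) :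
    realInner μ (cosMode (m + 2)) (monicOTP μ (2 * m + 1)) =
      jmath μ (m + 2) * b μ (m + 1) ^ 2 := by
  have h : jmath μ (m + 2) = _ :=
    realInner_inv_mul_inv_mul μ (cosMode (m + 2)) (monicOTP μ (2 * m + 1)) (b μ (m + 1))
  rw [h, div_mul_cancel₀ _ (b_succ_sq_pos hμ m).ne']

theorem realInner_sinMode_add_two_even (hμ : μ.support.Infinite) (m : ℕ) :
    realInner μ (sinMode (m + 2)) (monicOTP μ (2 * m + 2)) =
      varsigma μ (m + 2) * a μ (m + 1) ^ 2 := by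
  have h : varsigma μ (m + 2) = _ :=
    realInner_inv_mul_inv_mul μ (sinMode (m + 2)) (monicOTP μ (2 * m + 2)) (a μ (m + 1))
  rw [h, div_mul_cancel₀ _ (a_succ_sq_pos hμ m).ne']

theorem realInner_sinMode_add_two_odd (hμ : μ.support.Infinite) (m : ℕ) :
    realInner μ (sinMode (m + 2)) (monicOTP μ (2 * m + 1)) =
      zeta μ (m + 2) * b μ (m + 1) ^ 2 := by
  have h : zeta μ (m + 2) = _ :=
    realInner_inv_mul_inv_mul μ (sinMode (m + 2)) (monicOTP μ (2 * m + 1)) (b μ (m + 1))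
  rw [h, div_mul_cancel₀ _ (b_succ_sq_pos hμ m).ne']

theorem realInner_cosMode_of_lt (hμ : μ.support.Infinite) {n k : ℕ} (h : 2 * n < k) :
    realInner μ (cosMode n) (monicOTP μ k) = 0 := by
  rw [← trigSystem_two_mul]
  exact realInner_trigSystem_monicOTP_of_lt μ
    (fun k => (realInner_monicOTP_self_pos hμ k).ne') h

/-- For n ≥ 1 the n-th sine has index 2n - 1 in the system, whence the non-strict inequality; for n
= 0 it is the zero function. -/
theorem realInner_sinMode_of_le (hμ : μ.support.Infinite) {n k : ℕ} (h : 2 * n ≤ k) :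
    realInner μ (sinMode n) (monicOTP μ k) = 0 := by
  rcases n with _ | n
  · simp [realInner, sinMode]
  · rw [← trigSystem_two_mul_add_one]
    exact realInner_trigSystem_monicOTP_of_lt μ
      (fun k => (realInner_monicOTP_self_pos hμ k).ne') (by omega)

theorem realInner_cosMode_even (hμ : μ.support.Infinite) (m : ℕ) :
    realInner μ (cosMode (m + 1)) (monicOTP μ (2 * m + 2)) = a μ (m + 1) ^ 2 := by
  rw [a_succ_sq, ← trigSystem_two_mul]
  exact realInner_trigSystem_monicOTP_self μ (fun k => (realInner_monicOTP_self_pos hμ k).ne') _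

theorem realInner_sinMode_odd (hμ : μ.support.Infinite) (m : ℕ) :
    realInner μ (sinMode (m + 1)) (monicOTP μ (2 * m + 1)) = b μ (m + 1) ^ 2 := by
  rw [b_succ_sq, ← trigSystem_two_mul_add_one]
  exact realInner_trigSystem_monicOTP_self μ (fun k => (realInner_monicOTP_self_pos hμ k).ne') _

theorem integral_ofReal_mul_character {f : UnitCircle → ℝ} (hf : Continuous f) (n : ℕ) :
    ∫ τ, (f τ : ℂ) * character n τ ∂μ =
      realInner μ (cosMode n) f + Complex.I * realInner μ (sinMode n) f := by
  have hf' := Complex.continuous_ofReal.comp hf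
  simp_rw [character_eq_cosMode_add, mul_add, mul_left_comm _ Complex.I]
  rw [integral_add, integral_const_mul, integral_ofReal_mul_ofReal, integral_ofReal_mul_ofReal]
  · exact integrable_of_continuous μ
      (hf'.mul (Complex.continuous_ofReal.comp (continuous_cosMode n)))
  · exact (integrable_of_continuous μ
      (hf'.mul (Complex.continuous_ofReal.comp (continuous_sinMode n)))).const_mul _

theorem integral_ofReal_mul_character_neg {f : UnitCircle → ℝ} (hf : Continuous f) (n : ℕ) :
    ∫ τ, (f τ : ℂ) * character (-n) τ ∂μ =
      realInner μ (cosMode n) f - Complex.I * realInner μ (sinMode n) f := by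
  have h := integral_conj_mul_character (μ := μ) (fun τ => (f τ : ℂ)) (-n)
  simp_rw [Complex.conj_ofReal, neg_neg] at h
  rw [h, integral_ofReal_mul_character hf]
  simp [sub_eq_add_neg]

end Relations

/-! ### Orthogonal polynomials built from the real system, and their moments. -/

/-- The monic orthogonal polynomial of degree `2 m + 1`, divided by `τ ^ m`. -/
noncomputable def oddFactor (μ : Measure UnitCircle) (m : ℕ) (τ : UnitCircle) : ℂ :=
  monicOTP μ (2 * m + 2) τ + (beta μ (m + 1) + Complex.I) * monicOTP μ (2 * m + 1) τ

/-- The monic orthogonal polynomial of degree `2 m + 2`, divided by `τ ^ (m + 1)`. -/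
noncomputable def evenFactor (μ : Measure UnitCircle) (m : ℕ) (τ : UnitCircle) : ℂ :=
  oddFactor μ m τ - conj (schurParameter μ (2 * m + 1)) * conj (oddFactor μ m τ)

section Factors

variable {μ : Measure UnitCircle}

theorem continuous_oddFactor (m : ℕ) : Continuous (oddFactor μ m) :=
  (Complex.continuous_ofReal.comp (continuous_monicOTP μ _)).add
    ((Complex.continuous_ofReal.comp (continuous_monicOTP μ _)).const_mul _)

theorem continuous_conj_oddFactor (m : ℕ) : Continuous fun τ => conj (oddFactor μ m τ) :=
  Complex.continuous_conj.comp (continuous_oddFactor m)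

theorem continuous_evenFactor (m : ℕ) : Continuous (evenFactor μ m) :=
  (continuous_oddFactor m).sub ((continuous_conj_oddFactor m).const_mul _)

theorem continuous_conj_evenFactor (m : ℕ) : Continuous fun τ => conj (evenFactor μ m τ) :=
  Complex.continuous_conj.comp (continuous_evenFactor m)

/-- The summand β cancels the Gram–Schmidt sine coefficient of the cosine function, and i completes
cos + i sin to τ^(m+1); everything else has degree at most m. -/
theorem oddFactor_sub_character_mem (m : ℕ) :
    (fun τ => oddFactor μ m τ - character (m + 1 : ℕ) τ) ∈ trigPoly m := by
  obtain ⟨f, hf, h1⟩ := monicOTP_odd μ m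
  obtain ⟨g, hg, h2⟩ := monicOTP_even μ m
  convert add_mem hg ((trigPoly m).smul_mem Complex.I hf) using 1
  funext τ
  rw [oddFactor, h2, gsCoeff_eq_beta, h1, character_eq_cosMode_add, Pi.add_apply, Pi.smul_apply,
    smul_eq_mul]
  ring

theorem integral_conj_character_mul_mul (i : ℤ) (f : UnitCircle → ℂ) :
    ∫ τ, conj (character i τ * f τ) * character (-1) τ ∂μ =
      conj (∫ τ, f τ * character (i + 1) τ ∂μ) := by
  rw [integral_conj_mul_character, integral_character_mul_mul i _ _ (by rw [neg_neg])]

variable [IsProbabilityMeasure μ]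

theorem integral_oddFactor_mul_character (m : ℕ) (j : ℤ) :
    ∫ τ, oddFactor μ m τ * character j τ ∂μ =
      ∫ τ, (monicOTP μ (2 * m + 2) τ : ℂ) * character j τ ∂μ +
        (beta μ (m + 1) + Complex.I) *
          ∫ τ, (monicOTP μ (2 * m + 1) τ : ℂ) * character j τ ∂μ := by
  have h (k : ℕ) : Integrable (fun τ => (monicOTP μ k τ : ℂ) * character j τ) μ :=
    integrable_of_continuous μ ((Complex.continuous_ofReal.comp (continuous_monicOTP μ k)).mul
      (continuous_character j))
  simp_rw [oddFactor, add_mul _ _ (character _ _), mul_assoc]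
  rw [integral_add (h _) ((h _).const_mul _), integral_const_mul]

theorem integral_evenFactor_mul_character (m : ℕ) (j : ℤ) :
    ∫ τ, evenFactor μ m τ * character j τ ∂μ =
      ∫ τ, oddFactor μ m τ * character j τ ∂μ - conj (schurParameter μ (2 * m + 1)) *
          conj (∫ τ, oddFactor μ m τ * character (-j) τ ∂μ) := by
  simp_rw [evenFactor, sub_mul, mul_assoc]
  rw [integral_sub, integral_const_mul, integral_conj_mul_character]
  · exact integrable_of_continuous μ ((continuous_oddFactor m).mul (continuous_character j))
  · exact (integrable_of_continuous μ
      ((continuous_conj_oddFactor m).mul (continuous_character j))).const_mul _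

theorem integral_monicOTP_mul_character_of_lt (hμ : μ.support.Infinite) {m k : ℕ}
    (hk : 2 * m < k) {j : ℤ} (h1 : -m ≤ j) (h2 : j ≤ m) :
    ∫ τ, (monicOTP μ k τ : ℂ) * character j τ ∂μ = 0 := by
  obtain ⟨n, rfl | rfl⟩ := Int.eq_nat_or_neg j
  · rw [integral_ofReal_mul_character (continuous_monicOTP μ k),
      realInner_cosMode_of_lt hμ (by omega), realInner_sinMode_of_le hμ (by omega)]
    simp
  · rw [integral_ofReal_mul_character_neg (continuous_monicOTP μ k),
      realInner_cosMode_of_lt hμ (by omega), realInner_sinMode_of_le hμ (by omega)]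
    simp

theorem integral_oddFactor_of_le (hμ : μ.support.Infinite) {m : ℕ} {j : ℤ} (h1 : -m ≤ j)
    (h2 : j ≤ m) : ∫ τ, oddFactor μ m τ * character j τ ∂μ = 0 := by
  rw [integral_oddFactor_mul_character, integral_monicOTP_mul_character_of_lt hμ (by omega) h1 h2,
    integral_monicOTP_mul_character_of_lt hμ (by omega) h1 h2]
  simp

theorem integral_oddFactor_succ (hμ : μ.support.Infinite) (m : ℕ) :
    ∫ τ, oddFactor μ m τ * character (m + 1 : ℕ) τ ∂μ =
      (a μ (m + 1) : ℂ) ^ 2 + (beta μ (m + 1) + Complex.I) ^ 2 * (b μ (m + 1) : ℂ) ^ 2 := by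
  rw [integral_oddFactor_mul_character, integral_ofReal_mul_character (continuous_monicOTP μ _),
    integral_ofReal_mul_character (continuous_monicOTP μ _), realInner_cosMode_even hμ,
    realInner_sinMode_of_le hμ (by omega), realInner_cosMode_odd hμ, realInner_sinMode_odd hμ]
  push_cast
  ring

/-- The value is also the squared norm of A + (β + i)B, hence positive. -/
theorem integral_oddFactor_neg_succ (hμ : μ.support.Infinite) (m : ℕ) :
    ∫ τ, oddFactor μ m τ * character (-(m + 1 : ℕ)) τ ∂μ =
      (a μ (m + 1) : ℂ) ^ 2 + (b μ (m + 1) : ℂ) ^ 2 * (1 + (beta μ (m + 1) : ℂ) ^ 2) := by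
  rw [integral_oddFactor_mul_character,
    integral_ofReal_mul_character_neg (continuous_monicOTP μ _),
    integral_ofReal_mul_character_neg (continuous_monicOTP μ _), realInner_cosMode_even hμ,
    realInner_sinMode_of_le hμ (by omega), realInner_cosMode_odd hμ, realInner_sinMode_odd hμ]
  push_cast
  linear_combination -(b μ (m + 1) : ℂ) ^ 2 * Complex.I_sq

theorem integral_oddFactor_add_two (hμ : μ.support.Infinite) (m : ℕ) :
    ∫ τ, oddFactor μ m τ * character (m + 2 : ℕ) τ ∂μ =
      (a μ (m + 1) : ℂ) ^ 2 * (iota μ (m + 2) + Complex.I * varsigma μ (m + 2)) +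
        (beta μ (m + 1) + Complex.I) * (b μ (m + 1) : ℂ) ^ 2 *
          (jmath μ (m + 2) + Complex.I * zeta μ (m + 2)) := by
  rw [integral_oddFactor_mul_character, integral_ofReal_mul_character (continuous_monicOTP μ _),
    integral_ofReal_mul_character (continuous_monicOTP μ _), realInner_cosMode_add_two_even hμ,
    realInner_sinMode_add_two_even hμ, realInner_cosMode_add_two_odd hμ,
    realInner_sinMode_add_two_odd hμ]
  push_cast
  ring

theorem integral_oddFactor_neg_add_two (hμ : μ.support.Infinite) (m : ℕ) :
    ∫ τ, oddFactor μ m τ * character (-(m + 2 : ℕ)) τ ∂μ =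
      (a μ (m + 1) : ℂ) ^ 2 * (iota μ (m + 2) - Complex.I * varsigma μ (m + 2)) +
        (beta μ (m + 1) + Complex.I) * (b μ (m + 1) : ℂ) ^ 2 *
          (jmath μ (m + 2) - Complex.I * zeta μ (m + 2)) := by
  rw [integral_oddFactor_mul_character,
    integral_ofReal_mul_character_neg (continuous_monicOTP μ _),
    integral_ofReal_mul_character_neg (continuous_monicOTP μ _),
    realInner_cosMode_add_two_even hμ, realInner_sinMode_add_two_even hμ,
    realInner_cosMode_add_two_odd hμ, realInner_sinMode_add_two_odd hμ]
  push_cast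
  ring

theorem norm_sq_pos (hμ : μ.support.Infinite) (m : ℕ) :
    0 < a μ (m + 1) ^ 2 + b μ (m + 1) ^ 2 * (1 + beta μ (m + 1) ^ 2) := by
  have := a_succ_sq_pos hμ m
  have := b_succ_sq_pos hμ m
  positivity

theorem norm_sq_ne_zero (hμ : μ.support.Infinite) (m : ℕ) :
    (a μ (m + 1) : ℂ) ^ 2 + (b μ (m + 1) : ℂ) ^ 2 * (1 + (beta μ (m + 1) : ℂ) ^ 2) ≠ 0 := by
  exact_mod_cast (norm_sq_pos hμ m).ne'

/-! ### Induction along the Schur iterates. -/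

/-- The Schur iterate `f_{2m+1}` is the Cauchy quotient of the orthogonal polynomial of degree
`2 m + 1`. -/
def IsOddQuotient (μ : Measure UnitCircle) (m : ℕ) : Prop :=
  IsCauchyQuotient μ (2 * m + 1) (fun τ => character m τ * oddFactor μ m τ)
    (schurIterate μ (2 * m + 1))

/-- The Schur iterate `f_{2m+2}` is the Cauchy quotient of the orthogonal polynomial of degree
`2 m + 2`. -/
def IsEvenQuotient (μ : Measure UnitCircle) (m : ℕ) : Prop :=
  IsCauchyQuotient μ (2 * m + 2) (fun τ => character (m + 1 : ℕ) τ * evenFactor μ m τ)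
    (schurIterate μ (2 * m + 2))

theorem IsOddQuotient.schurParameter_eq {m : ℕ} (h : IsOddQuotient μ m) (hμ : μ.support.Infinite) :
    schurParameter μ (2 * m + 1) =
      ((a μ (m + 1) : ℂ) ^ 2 + (beta μ (m + 1) - Complex.I) ^ 2 * (b μ (m + 1) : ℂ) ^ 2) /
        ((a μ (m + 1) : ℂ) ^ 2 + (b μ (m + 1) : ℂ) ^ 2 * (1 + (beta μ (m + 1) : ℂ) ^ 2)) := by
  have h0 := h.apply_zero
  rw [integral_conj_character_mul_mul, integral_character_mul_mul _ _ (-(m + 1 : ℕ))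
    (by push_cast; ring), integral_oddFactor_neg_succ hμ] at h0
  have h1 := integral_oddFactor_succ hμ m
  push_cast at h1
  rw [h1] at h0
  simpa [schurParameter, sub_eq_add_neg] using h0

section

variable {m : ℕ} (h : IsOddQuotient μ m) (hμ : μ.support.Infinite)
include h hμ

theorem IsOddQuotient.integral_evenFactor_of_le {j : ℤ} (h1 : -m ≤ j) (h2 : j ≤ m + 1) :
    ∫ τ, evenFactor μ m τ * character j τ ∂μ = 0 := by
  rw [integral_evenFactor_mul_character]
  rcases h2.eq_or_lt with rfl | h2
  -- The top mode j = m + 1 is the only one not killed by orthogonality of the odd factor; here the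
  -- value of γ_{2m+1} makes the two moments cancel.
  · have e1 := integral_oddFactor_succ hμ m
    have e2 := integral_oddFactor_neg_succ hμ m
    push_cast at e1 e2
    rw [e1, e2, h.schurParameter_eq hμ]
    have := norm_sq_ne_zero hμ m
    simp only [map_div₀, map_add, map_mul, map_pow, map_sub, map_one, Complex.conj_ofReal,
      Complex.conj_I]
    field_simp
    ring
  · rw [integral_oddFactor_of_le hμ h1 (by omega), integral_oddFactor_of_le hμ (by omega)
      (by omega)]
    simp

theorem IsOddQuotient.integral_evenFactor_neg_succ :
    ∫ τ, evenFactor μ m τ * character (-(m + 1 : ℕ)) τ ∂μ =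
      4 * (a μ (m + 1) : ℂ) ^ 2 * (b μ (m + 1) : ℂ) ^ 2 /
        ((a μ (m + 1) : ℂ) ^ 2 + (b μ (m + 1) : ℂ) ^ 2 * (1 + (beta μ (m + 1) : ℂ) ^ 2)) := by
  rw [integral_evenFactor_mul_character, neg_neg, integral_oddFactor_succ hμ,
    integral_oddFactor_neg_succ hμ, h.schurParameter_eq hμ]
  have := norm_sq_ne_zero hμ m
  simp only [map_div₀, map_add, map_mul, map_pow, map_sub, map_one, Complex.conj_ofReal,
    Complex.conj_I]
  generalize (a μ (m + 1) : ℂ) = x at *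
  generalize (b μ (m + 1) : ℂ) = y at *
  generalize (beta μ (m + 1) : ℂ) = t at *
  field_simp
  ring_nf
  simp only [Complex.I_sq, Complex.I_pow_four]
  ring

theorem IsOddQuotient.integral_evenFactor_add_two :
    ∫ τ, evenFactor μ m τ * character (m + 2 : ℕ) τ ∂μ =
      2 * (a μ (m + 1) : ℂ) ^ 2 * (b μ (m + 1) : ℂ) ^ 2 /
        ((a μ (m + 1) : ℂ) ^ 2 + (b μ (m + 1) : ℂ) ^ 2 * (1 + (beta μ (m + 1) : ℂ) ^ 2)) *
      ((1 - beta μ (m + 1) * Complex.I) * (iota μ (m + 2) + Complex.I * varsigma μ (m + 2)) +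
        Complex.I * (jmath μ (m + 2) + Complex.I * zeta μ (m + 2))) := by
  rw [integral_evenFactor_mul_character, integral_oddFactor_add_two hμ,
    integral_oddFactor_neg_add_two hμ, h.schurParameter_eq hμ]
  have := norm_sq_ne_zero hμ m
  simp only [map_div₀, map_add, map_mul, map_pow, map_sub, map_one, Complex.conj_ofReal,
    Complex.conj_I]
  generalize (a μ (m + 1) : ℂ) = x at *
  generalize (b μ (m + 1) : ℂ) = y at *
  generalize (beta μ (m + 1) : ℂ) = t at *
  have hA : (iota μ (m + 2) : ℂ) - -Complex.I * varsigma μ (m + 2) =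
    iota μ (m + 2) + Complex.I * varsigma μ (m + 2) := by ring
  have hB : (jmath μ (m + 2) : ℂ) - -Complex.I * zeta μ (m + 2) =
    jmath μ (m + 2) + Complex.I * zeta μ (m + 2) := by ring
  rw [hA, hB]
  generalize (iota μ (m + 2) : ℂ) + Complex.I * varsigma μ (m + 2) = A at *
  generalize (jmath μ (m + 2) : ℂ) + Complex.I * zeta μ (m + 2) = B at *
  field_simp
  ring_nf
  simp only [Complex.I_sq, Complex.I_pow_three]
  ring

theorem IsOddQuotient.integral_evenFactor_neg_succ_ne_zero :
    ∫ τ, evenFactor μ m τ * character (-(m + 1 : ℕ)) τ ∂μ ≠ 0 := by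
  rw [h.integral_evenFactor_neg_succ hμ]
  have h1 := (a_succ_sq_pos hμ m).ne'
  have h2 := (b_succ_sq_pos hμ m).ne'
  have h3 := norm_sq_ne_zero hμ m
  refine div_ne_zero (mul_ne_zero (mul_ne_zero (by norm_num) ?_) ?_) h3
  · exact_mod_cast h1
  · exact_mod_cast h2

theorem IsOddQuotient.isEvenQuotient : IsEvenQuotient μ m := by
  refine IsCauchyQuotient.schurStep h ((continuous_character _).mul (continuous_oddFactor m))
    ((continuous_character _).mul (continuous_evenFactor m)) ?_ ?_ (Eventually.of_forall fun τ => ?_)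
  · rw [integral_character_mul_mul _ _ (-(m + 1 : ℕ)) (by push_cast; ring),
      integral_oddFactor_neg_succ hμ]
    exact norm_sq_ne_zero hμ m
  · rw [integral_character_mul_mul _ _ (-(m + 1 : ℕ)) (by push_cast; ring)]
    exact h.integral_evenFactor_neg_succ_ne_zero hμ
  · have e1 : character (m + 1 : ℕ) τ = character 1 τ * character m τ := by
      rw [← character_add]; congr 1; push_cast; ring
    have e2 : character (m + 1 : ℕ) τ = character (2 * m + 1 : ℕ) τ * character (-m) τ := by
      rw [← character_add]; congr 1; push_cast; ring
    rw [evenFactor, map_mul, conj_character, mul_sub]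
    change _ = _ - conj (schurParameter μ (2 * m + 1)) * _
    linear_combination oddFactor μ m τ * e1
      - conj (schurParameter μ (2 * m + 1)) * conj (oddFactor μ m τ) * e2

/-- This undivided form is the orthogonality relation at the top mode in the next Szegő step, and
also yields the even parameters. -/
theorem IsOddQuotient.schurParameter_mul :
    schurParameter μ (2 * m + 2) * ∫ τ, evenFactor μ m τ * character (-(m + 1 : ℕ)) τ ∂μ =
      conj (∫ τ, evenFactor μ m τ * character (m + 2 : ℕ) τ ∂μ) := by
  have h0 := (h.isEvenQuotient hμ).apply_zero
  rw [integral_conj_character_mul_mul, integral_character_mul_mul _ _ (-(m + 1 : ℕ))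
    (by push_cast; ring), eq_div_iff (h.integral_evenFactor_neg_succ_ne_zero hμ)] at h0
  rw [show ((m + 2 : ℕ) : ℤ) = (m + 1 : ℕ) + 1 by push_cast; ring]
  exact h0

theorem IsOddQuotient.schurParameter_even_eq :
    schurParameter μ (2 * m + 2) =
      ((1 + beta μ (m + 1) * Complex.I) * (iota μ (m + 2) - Complex.I * varsigma μ (m + 2)) -
        Complex.I * (jmath μ (m + 2) - Complex.I * zeta μ (m + 2))) / 2 := by
  have h0 := h.schurParameter_mul hμ
  rw [h.integral_evenFactor_neg_succ hμ, h.integral_evenFactor_add_two hμ] at h0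
  have h1 : (a μ (m + 1) : ℂ) ≠ 0 := by
    exact_mod_cast (pow_ne_zero_iff two_ne_zero).1 (a_succ_sq_pos hμ m).ne'
  have h2 : (b μ (m + 1) : ℂ) ≠ 0 := by
    exact_mod_cast (pow_ne_zero_iff two_ne_zero).1 (b_succ_sq_pos hμ m).ne'
  have h3 := norm_sq_ne_zero hμ m
  simp only [map_div₀, map_add, map_mul, map_pow, map_sub, map_one, Complex.conj_ofReal,
    Complex.conj_I, map_ofNat] at h0
  generalize (a μ (m + 1) : ℂ) = x at *
  generalize (b μ (m + 1) : ℂ) = y at *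
  generalize (beta μ (m + 1) : ℂ) = t at *
  field_simp at h0
  linear_combination h0 / 4

/-- Both sides have leading term τ^(m+2) and no τ^(-m-2) term, so their difference has degree at
most m + 1; it is orthogonal to every mode of that degree. -/
theorem IsOddQuotient.oddFactor_succ_ae_eq :
    ∀ᵐ τ ∂μ, oddFactor μ (m + 1) τ = character 1 τ * evenFactor μ m τ
      - conj (schurParameter μ (2 * m + 2)) * conj (evenFactor μ m τ) := by
  set c := conj (schurParameter μ (2 * m + 1)) with hc
  set d := conj (schurParameter μ (2 * m + 2)) with hd
  have hv := oddFactor_sub_character_mem (μ := μ) m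
  have hv' := conj_mem_trigPoly hv
  have hchar {j : ℤ} (h1 : -(m + 1 : ℕ) ≤ j) (h2 : j ≤ (m + 1 : ℕ)) :
    character j ∈ trigPoly (m + 1) := character_mem_trigPoly h1 h2
  have hodd : oddFactor μ m ∈ trigPoly (m + 1) := by
    convert add_mem (trigPoly_mono m.le_succ hv) (hchar (j := (m + 1 : ℕ)) (by omega) le_rfl)
      using 1
    funext τ; simp
  have heven : evenFactor μ m ∈ trigPoly (m + 1) :=
    sub_mem hodd ((trigPoly _).smul_mem _ (conj_mem_trigPoly hodd))
  have hmem : (fun τ => oddFactor μ (m + 1) τ - character 1 τ * evenFactor μ m τ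
      + d * conj (evenFactor μ m τ)) ∈ trigPoly (m + 1) := by
    convert add_mem (sub_mem (oddFactor_sub_character_mem (μ := μ) (m + 1))
      (sub_mem (character_mul_mem_trigPoly hv) ((trigPoly (m + 1)).smul_mem c
        (add_mem (hchar (j := -m) (by omega) (by omega)) (character_mul_mem_trigPoly hv')))))
      ((trigPoly (m + 1)).smul_mem d (conj_mem_trigPoly heven)) using 1
    funext τ
    have e1 : character (m + 1 + 1 : ℕ) τ = character 1 τ * character (m + 1 : ℕ) τ := by
      rw [← character_add]; congr 1; push_cast; ring
    have e2 : character (-m) τ = character 1 τ * character (-(m + 1 : ℕ)) τ := by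
      rw [← character_add]; congr 1; push_cast; ring
    simp only [Pi.add_apply, Pi.sub_apply, Pi.smul_apply, smul_eq_mul, map_sub, conj_character]
    rw [e1, e2, evenFactor, ← hc]
    ring
  have hcu := continuous_evenFactor (μ := μ) m
  have hcu' := continuous_conj_evenFactor (μ := μ) m
  have hint : ∀ j : ℤ, -(m + 1 : ℕ) ≤ j → j ≤ (m + 1 : ℕ) →
      ∫ τ, (oddFactor μ (m + 1) τ - character 1 τ * evenFactor μ m τ
        + d * conj (evenFactor μ m τ)) * character j τ ∂μ = 0 := by
    intro j h1 h2
    have hcj := continuous_character j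
    have i1 := integrable_mul_of_continuous μ (continuous_oddFactor (μ := μ) (m + 1)) hcj
    have i2 := integrable_mul_of_continuous μ
      (f := fun τ => character 1 τ * evenFactor μ m τ) ((continuous_character 1).mul hcu) hcj
    have i3 := (integrable_mul_of_continuous μ hcu' hcj).const_mul d
    have i12 : Integrable (fun τ => oddFactor μ (m + 1) τ * character j τ
      - character 1 τ * evenFactor μ m τ * character j τ) μ := i1.sub i2
    simp_rw [add_mul, sub_mul, mul_assoc d]
    rw [integral_add i12 i3, integral_sub i1 i2, integral_const_mul,
      integral_oddFactor_of_le hμ h1 h2, integral_character_mul_mul 1 j (j + 1) (add_comm _ _),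
      integral_conj_mul_character]
    -- At j = m + 1 the moments of the even factor cancel by the choice of γ_{2m+2}; below it they
    -- vanish separately.
    rcases h2.eq_or_lt with rfl | h2
    · have e := congrArg conj (h.schurParameter_mul hμ)
      rw [map_mul, Complex.conj_conj, ← hd] at e
      have e' : ((m + 1 : ℕ) : ℤ) + 1 = (m + 2 : ℕ) := by push_cast; ring
      rw [e', e]
      ring
    · rw [h.integral_evenFactor_of_le hμ (by omega) (by omega),
        h.integral_evenFactor_of_le hμ (by omega) (by omega)]
      simp
  filter_upwards [ae_zero_of_mem_trigPoly hmem hint] with τ hτ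
  have hτ : oddFactor μ (m + 1) τ - character 1 τ * evenFactor μ m τ
      + d * conj (evenFactor μ m τ) = 0 := hτ
  linear_combination hτ

theorem IsOddQuotient.succ : IsOddQuotient μ (m + 1) := by
  refine IsCauchyQuotient.schurStep (h.isEvenQuotient hμ)
    ((continuous_character _).mul (continuous_evenFactor m))
    ((continuous_character _).mul (continuous_oddFactor _)) ?_ ?_ ?_
  · rw [integral_character_mul_mul _ _ (-(m + 1 : ℕ)) (by push_cast; ring)]
    exact h.integral_evenFactor_neg_succ_ne_zero hμ
  · rw [integral_character_mul_mul _ _ (-(m + 1 + 1 : ℕ)) (by push_cast; ring),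
      integral_oddFactor_neg_succ hμ]
    exact norm_sq_ne_zero hμ (m + 1)
  · filter_upwards [h.oddFactor_succ_ae_eq hμ] with τ hτ
    have e2 : character (m + 1 : ℕ) τ =
        character (2 * m + 2 : ℕ) τ * character (-(m + 1 : ℕ)) τ := by
      rw [← character_add]; congr 1; push_cast; ring
    rw [hτ, map_mul, conj_character]
    change _ = _ - conj (schurParameter μ (2 * m + 2)) * _
    linear_combination
      - conj (schurParameter μ (2 * m + 2)) * conj (evenFactor μ m τ) * e2

end

/-! ### The base case and the parameter of index zero. -/

theorem schurParameter_zero_eq_integral :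
    schurParameter μ 0 = ∫ τ, character (-1) τ ∂μ := by
  have h := (isCauchyQuotient_schurFunction μ).apply_zero
  simpa [schurParameter, schurIterate, character_zero] using h

theorem isOddQuotient_zero (hμ : μ.support.Infinite) : IsOddQuotient μ 0 := by
  have hconj : conj (schurFunction μ 0) = ∫ τ, character 1 τ ∂μ := by
    have h : schurFunction μ 0 = _ := schurParameter_zero_eq_integral (μ := μ)
    rw [h, ← integral_conj]
    simp_rw [conj_character, neg_neg]
  refine (isCauchyQuotient_schurFunction μ).schurStep continuous_const
    ((continuous_character _).mul (continuous_oddFactor _)) ?_ ?_ ?_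
  · simp [character_zero]
  · rw [integral_character_mul_mul _ _ (-(0 + 1 : ℕ)) (by simp),
      integral_oddFactor_neg_succ hμ]
    exact norm_sq_ne_zero hμ 0
  · set d := conj (schurFunction μ 0)
    -- In degree 0 the difference is a constant, so integrating against 1 alone identifies it; the
    -- mean of τ is conj γ₀.
    have hmem : (fun τ => oddFactor μ 0 τ - character 1 τ + d) ∈ trigPoly 0 := by
      convert add_mem (oddFactor_sub_character_mem (μ := μ) 0) ((trigPoly 0).smul_mem d
        (character_mem_trigPoly (m := 0) (j := 0) le_rfl le_rfl)) using 1
      funext τ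
      simp [character_zero]
    have hint : ∀ j : ℤ, -(0 : ℕ) ≤ j → j ≤ (0 : ℕ) →
        ∫ τ, (oddFactor μ 0 τ - character 1 τ + d) * character j τ ∂μ = 0 := by
      intro j h1 h2
      obtain rfl : j = 0 := by omega
      have h0 := integral_oddFactor_of_le hμ (m := 0) h1 h2
      simp_rw [character_zero, mul_one] at h0 ⊢
      have i1 := integrable_of_continuous μ (continuous_oddFactor (μ := μ) 0)
      have i2 := integrable_of_continuous μ (continuous_character 1)
      have i12 : Integrable (fun τ => oddFactor μ 0 τ - character 1 τ) μ := i1.sub i2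
      rw [integral_add i12 (integrable_const d), integral_sub i1 i2, h0, hconj]
      simp
    filter_upwards [ae_zero_of_mem_trigPoly hmem hint] with τ hτ
    have hτ : oddFactor μ 0 τ - character 1 τ + d = 0 := hτ
    simp only [Nat.cast_zero, character_zero, map_one]
    linear_combination hτ

theorem isOddQuotient (hμ : μ.support.Infinite) (m : ℕ) : IsOddQuotient μ m := by
  induction m with
  | zero => exact isOddQuotient_zero hμ
  | succ m ih => exact ih.succ hμ

theorem schurParameter_zero_eq : schurParameter μ 0 = iota μ 1 - Complex.I * varsigma μ 1 := by
  have h := integral_ofReal_mul_character_neg (μ := μ) (f := fun _ => 1) continuous_const 1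
  simp only [Complex.ofReal_one, one_mul, Nat.cast_one] at h
  rw [schurParameter_zero_eq_integral, h]
  simp [iota, varsigma, a, sigma]

end Factors

end OTP

theorem theorem3p4 (μ : MeasureTheory.Measure OTP.UnitCircle)
    [MeasureTheory.IsProbabilityMeasure μ] (hμ : μ.support.Infinite) :
    (∀ n : ℕ, 1 ≤ n →
      OTP.schurParameter μ (2 * n - 1) =
        (((OTP.a μ n ^ 2 - OTP.b μ n ^ 2 * (1 - OTP.beta μ n ^ 2)) /
            (OTP.a μ n ^ 2 + OTP.b μ n ^ 2 * (1 + OTP.beta μ n ^ 2)) : ℝ) : ℂ)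
          - ((2 * OTP.b μ n ^ 2 * OTP.beta μ n /
            (OTP.a μ n ^ 2 + OTP.b μ n ^ 2 * (1 + OTP.beta μ n ^ 2)) : ℝ) : ℂ) * Complex.I) ∧
    (∀ n : ℕ, 2 ≤ n →
      OTP.schurParameter μ (2 * n - 2) =
        1 / 2 * ((OTP.iota μ n + OTP.beta μ (n - 1) * OTP.varsigma μ n - OTP.zeta μ n : ℝ) : ℂ)
          - Complex.I / 2 *
            ((OTP.jmath μ n - OTP.iota μ n * OTP.beta μ (n - 1) + OTP.varsigma μ n : ℝ) : ℂ)) ∧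
    OTP.schurParameter μ 0 =
      (OTP.iota μ 1 : ℂ) - Complex.I * (OTP.varsigma μ 1 : ℂ) := by

  refine ⟨fun n hn => ?_, fun n hn => ?_, OTP.schurParameter_zero_eq⟩
  · obtain ⟨m, rfl⟩ := Nat.exists_eq_add_of_le' hn
    have h3 := OTP.norm_sq_ne_zero hμ m
    rw [show 2 * (m + 1) - 1 = 2 * m + 1 by omega,
      (OTP.isOddQuotient hμ m).schurParameter_eq hμ]
    push_cast
    field_simp
    linear_combination (OTP.b μ (m + 1) : ℂ) ^ 2 * Complex.I_sq
  · obtain ⟨m, rfl⟩ := Nat.exists_eq_add_of_le' hn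
    rw [show 2 * (m + 2) - 2 = 2 * m + 2 by omega,
      (OTP.isOddQuotient hμ m).schurParameter_even_eq hμ]
    -- For n = m + 2 the truncated difference n - 1 is m + 1 by definition.
    change _ = 1 / 2 * ((_ + OTP.beta μ (m + 1) * _ - _ : ℝ) : ℂ)
      - Complex.I / 2 * ((_ - _ * OTP.beta μ (m + 1) + _ : ℝ) : ℂ)
    push_cast
    linear_combination (-(OTP.beta μ (m + 1) : ℂ) * OTP.varsigma μ (m + 2)
      + OTP.zeta μ (m + 2)) / 2 * Complex.I_sq
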